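/- Let $k>1$ and let $n_1\ge n_2\ge\cdots\ge n_k\ge 2$ be integers, $N=\prod_{i=1}^k n_i$. Write $M_d$ for the space of $d\times d$ complex matrices, and identify $M_N=M_{n_1}\otimes\cdots\otimes M_{n_k}$ by means of the Kronecker product. Let $\mathcal P_d\subset M_d$ be the set of Hermitian matrices of rank one and trace one. For $T\in M_N$ define the product numerical range $$W^{\otimes}(T)=\{\operatorname{tr}(TZ): Z=P_1\otimes\cdots\otimes P_k,\ P_i\in\mathcal P_{n_i}\text{ for } i=1,\dots,k\}\subset\mathbb C.$$ Let $\Psi:M_N\to M_N$ be a complex linear map, and let $\Psi^*$ be its dual map with respect to the inner product $\langle X,Y\rangle=\operatorname{tr}(XY^*)$, so that $\langle\Psi(X),Y\rangle=\langle X,\Psi^*(Y)\rangle$ for all $X,Y\in M_N$. Then the following are equivalent. (a) $W^{\otimes}(\Psi^*(T))=W^{\otimes}(T)$ for all $T\in M_N$. (b) $\operatorname{conv} W^{\otimes}(\Psi^*(T))=\operatorname{conv} W^{\otimes}(T)$ for all $T\in M_N$. (c) There are a permutation $\pi$ of $\{1,\dots,k\}$ with $n_{\pi(i)}=n_i$ for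 all $i$, and linear maps $\psi_i$ on $M_{n_i}$, each of the form $X\mapsto U_iXU_i^*$ or $X\mapsto U_iX^{\mathsf T}U_i^*$ for some unitary $U_i\in M_{n_i}$, such that $$\Psi(A_1\otimes\cdots\otimes A_k)=\psi_1(A_{\pi(1)})\otimes\cdots\otimes\psi_k(A_{\pi(k)})\quad\text{for all } A_i\in M_{n_i},\ i=1,\dots,k.$$ -/

import Mathlib

namespace ProductNumericalRange

/-- The space `M_d` of `d × d` complex matrices. -/
abbrev Mat (d : ℕ) : Type := Matrix (Fin d) (Fin d) ℂ

/-- The space `M_N = M_{n_1} ⊗ ⋯ ⊗ M_{n_k}`, `N = ∏ i, n i`: complex matrices whose rows and columns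
are indexed by the `N` tuples `(r_1, …, r_k)` with `r_i` in `Fin (n i)`, that is, by the standard
product basis of `ℂ^{n_1} ⊗ ⋯ ⊗ ℂ^{n_k}`. -/
abbrev MultiMat {k : ℕ} (n : Fin k → ℕ) : Type :=
  Matrix ((i : Fin k) → Fin (n i)) ((i : Fin k) → Fin (n i)) ℂ

/-- The set `P_d` of pure states: Hermitian rank one matrices of trace one. -/
def pureStates (d : ℕ) : Set (Mat d) :=
  {P | P.IsHermitian ∧ P.rank = 1 ∧ P.trace = 1}

/-- The tensor (Kronecker) product `A_1 ⊗ ⋯ ⊗ A_k`. -/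
def tensor {k : ℕ} {n : Fin k → ℕ} (A : (i : Fin k) → Mat (n i)) : MultiMat n :=
  Matrix.of fun r c => ∏ i, A i (r i) (c i)

/-- The set `P_{n_1} ⊗ ⋯ ⊗ P_{n_k}` of product (separable) pure states. -/
def productPureStates {k : ℕ} (n : Fin k → ℕ) : Set (MultiMat n) :=
  {Z | ∃ P : (i : Fin k) → Mat (n i), (∀ i, P i ∈ pureStates (n i)) ∧ Z = tensor P}

/-- The product numerical range `W^⊗(T) = {tr (T Z) : Z ∈ P_{n_1} ⊗ ⋯ ⊗ P_{n_k}}`. -/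
def productRange {k : ℕ} {n : Fin k → ℕ} (T : MultiMat n) : Set ℂ :=
  {w | ∃ Z ∈ productPureStates n, w = (T * Z).trace}

/-- The standard inner product `⟨X, Y⟩ = tr (X Y*)` on square complex matrices. -/
def hsInner {ι : Type*} [Fintype ι] (X Y : Matrix ι ι ℂ) : ℂ :=
  (X * Y.conjTranspose).trace

theorem hsInner_eq_sum {ι : Type*} [Fintype ι] (X Y : Matrix ι ι ℂ) :
    hsInner X Y = ∑ r, ∑ c, X r c * star (Y r c) := by
  simp [hsInner, Matrix.trace, Matrix.mul_apply]

/-- The dual map `Ψ*` with respect to `hsInner`. Its `(r, c)` entry at `Y` is the conjugate of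
`⟨Ψ(E_{rc}), Y⟩`; the two theorems below show that it is the unique map with
`⟨Ψ(X), Y⟩ = ⟨X, Ψ*(Y)⟩` for all `X` and `Y`. -/
def dualMap {ι : Type*} [Fintype ι] [DecidableEq ι]
    (Ψ : Matrix ι ι ℂ →ₗ[ℂ] Matrix ι ι ℂ) : Matrix ι ι ℂ →ₗ[ℂ] Matrix ι ι ℂ where
  toFun Y := Matrix.of fun r c => star (hsInner (Ψ (Matrix.single r c 1)) Y)
  map_add' Y Z := by
    ext r c
    simp [hsInner, Matrix.mul_add]
  map_smul' a Y := by
    ext r c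
    simp [hsInner]

theorem hsInner_dualMap {ι : Type*} [Fintype ι] [DecidableEq ι]
    (Ψ : Matrix ι ι ℂ →ₗ[ℂ] Matrix ι ι ℂ) (X Y : Matrix ι ι ℂ) :
    hsInner (Ψ X) Y = hsInner X (dualMap Ψ Y) := by
  rw [hsInner_eq_sum X]
  have h : ∀ r c, star (dualMap Ψ Y r c) = hsInner (Ψ (Matrix.single r c 1)) Y := by
    intro r c
    simp [dualMap]
  simp only [h]
  conv_lhs => rw [Matrix.matrix_eq_sum_single X]
  have hs : ∀ r c, Matrix.single r c (X r c) = X r c • Matrix.single r c (1 : ℂ) := by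
    intro r c
    simp
  simp only [hs, map_sum, map_smul]
  simp [hsInner, Matrix.sum_mul, Matrix.trace_sum]

theorem eq_dualMap {ι : Type*} [Fintype ι] [DecidableEq ι]
    (Ψ : Matrix ι ι ℂ →ₗ[ℂ] Matrix ι ι ℂ) (Φ : Matrix ι ι ℂ → Matrix ι ι ℂ)
    (h : ∀ X Y, hsInner (Ψ X) Y = hsInner X (Φ Y)) (Y : Matrix ι ι ℂ) :
    Φ Y = dualMap Ψ Y := by
  ext r c
  have h1 := h (Matrix.single r c 1) Y
  have h2 : hsInner (Matrix.single r c 1) (Φ Y) = star (Φ Y r c) := by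
    simp [hsInner, Matrix.trace_single_mul]
  rw [h2] at h1
  simp [dualMap, h1]

/-- `ψ` has the form `X ↦ U X U*` or `X ↦ U Xᵀ U*` for some unitary `U`. -/
def IsStandard {d : ℕ} (ψ : Mat d →ₗ[ℂ] Mat d) : Prop :=
  ∃ U ∈ Matrix.unitaryGroup (Fin d) ℂ,
    (∀ X, ψ X = U * X * U.conjTranspose) ∨ (∀ X, ψ X = U * X.transpose * U.conjTranspose)

/-- There are a permutation `π` of the factors with `n (π i) = n i` and maps `ψ i` of the form
`X ↦ U X U*` or `X ↦ U Xᵀ U*`, `U` unitary, with `Ψ (⨂ A_i) = ⨂ ψ_i (A_{π i})`.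
The reindexing only views the `n (π i) × n (π i)` matrix `A (π i)` as an `n i × n i` matrix. -/
def HasProductForm {k : ℕ} {n : Fin k → ℕ} (Ψ : MultiMat n →ₗ[ℂ] MultiMat n) : Prop :=
  ∃ (π : Equiv.Perm (Fin k)) (h : ∀ i, n (π i) = n i)
    (ψ : (i : Fin k) → Mat (n i) →ₗ[ℂ] Mat (n i)),
    (∀ i, IsStandard (ψ i)) ∧
    ∀ A : (i : Fin k) → Mat (n i),
      Ψ (tensor A) =
        tensor fun i => ψ i (Matrix.reindex (finCongr (h i)) (finCongr (h i)) (A (π i)))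

end ProductNumericalRange

/-! Both range conditions amount to one statement: `Ψ` maps the set of product pure states onto
itself. Since `tr (Ψ*(T) Z) = tr (T Ψ(Z)*)` for a product state `Z`, this statement gives (a).
Conversely, product states are unit vectors for the Hilbert–Schmidt norm. Condition (b) yields, for
each product state `P`, a product state `Z` with `‖Ψ Z‖ ≤ 1` and `Re ⟨P, Ψ Z⟩ ≥ 1`, so `Ψ Z = P` by
the equality case of Cauchy–Schwarz. Product states span, hence `Ψ` is invertible, and the inverse
inherits (b); this is `image_eq_of_convexHull_eq`.

It remains to find the linear maps permuting product states. Two of them differ in exactly one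
factor iff their sum is a sum of two product states in another way (`exists_differOnlyAt_iff`), a
condition that linear bijections permuting product states preserve. So `Ψ` induces an automorphism
of a Hamming graph, which permutes the coordinates and acts on each separately
(`exists_perm_of_differOnlyAt_iff`). Partial traces make each coordinate action linear, a dimension
count matches the sizes, and a linear form of Wigner's theorem (`isStandard_of_image_pureStates`)
identifies each action: it is a Jordan *-homomorphism, hence a unitary conjugation, possibly after
transposition. -/

namespace ProductNumericalRange

open Matrix
open scoped ComplexOrder

/-! ### Hilbert–Schmidt norm and the equality case of Cauchy–Schwarz. -/

section HilbertSchmidt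

variable {ι : Type*} [Fintype ι]

theorem re_trace_conjTranspose_mul_self (A : Matrix ι ι ℂ) :
    (Aᴴ * A).trace.re = ∑ c, ∑ r, Complex.normSq (A r c) := by
  simp [trace, mul_apply, Complex.normSq_apply]

theorem eq_zero_of_re_trace_conjTranspose_mul_self_nonpos {A : Matrix ι ι ℂ}
    (h : (Aᴴ * A).trace.re ≤ 0) : A = 0 := by
  rw [re_trace_conjTranspose_mul_self] at h
  have h0 : ∀ c ∈ Finset.univ, 0 ≤ ∑ r, Complex.normSq (A r c) := fun c _ =>
    Finset.sum_nonneg fun r _ => Complex.normSq_nonneg _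
  have h1 := (Finset.sum_eq_zero_iff_of_nonneg h0).1 (le_antisymm h (Finset.sum_nonneg h0))
  ext r c
  have h2 := (Finset.sum_eq_zero_iff_of_nonneg fun r _ => Complex.normSq_nonneg (A r c)).1
    (h1 c (Finset.mem_univ c)) r (Finset.mem_univ r)
  simpa using h2

theorem re_trace_conjTranspose_mul_self_nonneg (A : Matrix ι ι ℂ) :
    0 ≤ (Aᴴ * A).trace.re := by
  rw [re_trace_conjTranspose_mul_self]
  exact Finset.sum_nonneg fun c _ => Finset.sum_nonneg fun r _ => Complex.normSq_nonneg _

theorem re_trace_conjTranspose_mul_comm (A B : Matrix ι ι ℂ) :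
    (Aᴴ * B).trace.re = (Bᴴ * A).trace.re := by
  have h : (Aᴴ * B).trace = star (Bᴴ * A).trace := by
    rw [← trace_conjTranspose, conjTranspose_mul, conjTranspose_conjTranspose]
  simp [h]

theorem re_trace_conjTranspose_sub_mul_sub (A B : Matrix ι ι ℂ) :
    ((A - B)ᴴ * (A - B)).trace.re =
      (Aᴴ * A).trace.re + (Bᴴ * B).trace.re - 2 * (Aᴴ * B).trace.re := by
  have h := re_trace_conjTranspose_mul_comm A B
  simp only [conjTranspose_sub, sub_mul, mul_sub, trace_sub, Complex.sub_re]
  linarith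

/-- Expanding gives `‖A - B‖² = ‖A‖² + ‖B‖² - 2 Re ⟨A, B⟩ ≤ 0`. -/
theorem eq_of_re_trace_conjTranspose_mul_eq_one {A B : Matrix ι ι ℂ}
    (hA : (Aᴴ * A).trace.re ≤ 1) (hB : (Bᴴ * B).trace.re ≤ 1) (h : 1 ≤ (Aᴴ * B).trace.re) :
    A = B := by
  refine sub_eq_zero.1 (eq_zero_of_re_trace_conjTranspose_mul_self_nonpos ?_)
  rw [re_trace_conjTranspose_sub_mul_sub]
  linarith

theorem two_mul_re_trace_conjTranspose_mul_le (A B : Matrix ι ι ℂ) :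
    2 * (Aᴴ * B).trace.re ≤ (Aᴴ * A).trace.re + (Bᴴ * B).trace.re := by
  have := re_trace_conjTranspose_mul_self_nonneg (A - B)
  rw [re_trace_conjTranspose_sub_mul_sub] at this
  linarith

end HilbertSchmidt

/-! ### Pure states as rank-one projections. -/

section PureStates

variable {d : ℕ}

/-- A Hermitian matrix is diagonal in an orthonormal frame. -/
theorem exists_unitary_eq_sum {H : Mat d} (hH : H.IsHermitian) :
    ∃ U ∈ unitaryGroup (Fin d) ℂ,
      H = ∑ i, (hH.eigenvalues i : ℂ) • vecMulVec (U.col i) (star (U.col i)) := by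
  refine ⟨hH.eigenvectorUnitary, hH.eigenvectorUnitary.2, ?_⟩
  conv_lhs => rw [hH.spectral_theorem, Unitary.conjStarAlgAut_apply]
  ext r c
  simp [mul_apply, vecMulVec_apply, Matrix.sum_apply, diagonal_apply, star_apply]
  refine Finset.sum_congr rfl fun i _ => by ring

theorem vecMulVec_star_mem_pureStates {v : Fin d → ℂ} (hv : star v ⬝ᵥ v = 1) :
    vecMulVec v (star v) ∈ pureStates d := by
  have hv0 : v ≠ 0 := by
    rintro rfl
    simp at hv
  refine ⟨?_, ?_, ?_⟩
  · rw [IsHermitian, conjTranspose_vecMulVec, star_star]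
  · refine le_antisymm (rank_vecMulVec_le _ _) (Nat.one_le_iff_ne_zero.2 fun h => ?_)
    have h1 := (Submodule.finrank_eq_zero.1 h : LinearMap.range _ = ⊥)
    rw [LinearMap.range_eq_bot] at h1
    have h2 := LinearMap.congr_fun h1 v
    rw [mulVecLin_apply, vecMulVec_mulVec, hv] at h2
    exact hv0 (by simpa using h2)
  · rw [trace_vecMulVec, dotProduct_comm, hv]

theorem col_dotProduct_col {U : Mat d} (hU : U ∈ unitaryGroup (Fin d) ℂ) (i j : Fin d) :
    star (U.col i) ⬝ᵥ U.col j = if i = j then 1 else 0 := by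
  have h := congrFun (congrFun (mem_unitaryGroup_iff'.1 hU) i) j
  rw [one_apply] at h
  rw [← h]
  simp [mul_apply, dotProduct, star_apply]

theorem mem_pureStates_iff {P : Mat d} :
    P ∈ pureStates d ↔ ∃ v : Fin d → ℂ, star v ⬝ᵥ v = 1 ∧ P = vecMulVec v (star v) := by
  constructor
  · rintro ⟨hP, hr, ht⟩
    obtain ⟨U, hU, h⟩ := exists_unitary_eq_sum hP
    rw [hP.rank_eq_card_non_zero_eigs, Fintype.card_eq_one_iff] at hr
    obtain ⟨⟨j, hj⟩, hr⟩ := hr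
    have h0 : ∀ i, i ≠ j → hP.eigenvalues i = 0 := fun i hi => by
      by_contra h
      exact hi (congrArg Subtype.val (hr ⟨i, h⟩))
    rw [hP.trace_eq_sum_eigenvalues,
      Finset.sum_eq_single j (fun i _ hi => by simp [h0 i hi]) (by simp)] at ht
    rw [Finset.sum_eq_single j (fun i _ hi => by simp [h0 i hi]) (by simp)] at h
    have ht' : (hP.eigenvalues j : ℂ) = 1 := ht
    rw [ht', one_smul] at h
    exact ⟨U.col j, by simp [col_dotProduct_col hU], h⟩
  · rintro ⟨v, hv, rfl⟩
    exact vecMulVec_star_mem_pureStates hv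

theorem mul_self_of_mem_pureStates {P : Mat d} (hP : P ∈ pureStates d) : P * P = P := by
  obtain ⟨v, hv, rfl⟩ := mem_pureStates_iff.1 hP
  rw [vecMulVec_mul_vecMulVec, hv, one_smul]

theorem trace_mul_self_of_mem_pureStates {P : Mat d} (hP : P ∈ pureStates d) :
    (P * P).trace = 1 := by
  rw [mul_self_of_mem_pureStates hP, hP.2.2]

/-- Idempotence gives `tr (P Q) = ‖P Q‖²`, hence real and nonnegative; the upper bound is
Cauchy–Schwarz. -/
theorem trace_mul_of_mem_pureStates {P Q : Mat d} (hP : P ∈ pureStates d)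
    (hQ : Q ∈ pureStates d) : ∃ t : ℝ, 0 ≤ t ∧ t ≤ 1 ∧ (P * Q).trace = t := by
  have h2 : (P * Q).trace.re ≤ 1 := by
    have := two_mul_re_trace_conjTranspose_mul_le P Q
    rw [hP.1.eq, hQ.1.eq, trace_mul_self_of_mem_pureStates hP,
      trace_mul_self_of_mem_pureStates hQ, Complex.one_re] at this
    linarith
  have h1 : (P * Q).trace = ((P * Q)ᴴ * (P * Q)).trace := by
    rw [conjTranspose_mul, hP.1.eq, hQ.1.eq, Matrix.mul_assoc, ← Matrix.mul_assoc P P,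
      mul_self_of_mem_pureStates hP, Matrix.trace_mul_comm Q, Matrix.mul_assoc,
      mul_self_of_mem_pureStates hQ]
  have h3 : (starRingEnd ℂ) (P * Q).trace = (P * Q).trace := by
    rw [← Complex.star_def, ← trace_conjTranspose, conjTranspose_mul, hP.1.eq, hQ.1.eq,
      Matrix.trace_mul_comm]
  refine ⟨(P * Q).trace.re, ?_, h2, (Complex.conj_eq_iff_re.1 h3).symm⟩
  rw [h1]
  exact re_trace_conjTranspose_mul_self_nonneg _

theorem eq_of_trace_mul_eq_one {P Q : Mat d} (hP : P ∈ pureStates d)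
    (hQ : Q ∈ pureStates d) (h : (P * Q).trace = 1) : P = Q := by
  apply eq_of_re_trace_conjTranspose_mul_eq_one
  · rw [hP.1.eq, trace_mul_self_of_mem_pureStates hP, Complex.one_re]
  · rw [hQ.1.eq, trace_mul_self_of_mem_pureStates hQ, Complex.one_re]
  · rw [hP.1.eq, h, Complex.one_re]

theorem mul_eq_zero_of_trace_mul_eq_zero {P Q : Mat d} (hP : P ∈ pureStates d)
    (hQ : Q ∈ pureStates d) (h : (P * Q).trace = 0) : P * Q = 0 := by
  apply eq_zero_of_re_trace_conjTranspose_mul_self_nonpos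
  rw [conjTranspose_mul, hP.1.eq, hQ.1.eq, Matrix.mul_assoc, ← Matrix.mul_assoc P P,
    mul_self_of_mem_pureStates hP, Matrix.trace_mul_comm Q, Matrix.mul_assoc,
    mul_self_of_mem_pureStates hQ, h, Complex.zero_re]

theorem vecMulVec_star_eq_smul {d : ℕ} (v : Fin d → ℂ) :
    v = 0 ∨ ∃ P ∈ pureStates d, ∃ t : ℝ, 0 ≤ t ∧ vecMulVec v (star v) = (t : ℂ) • P := by
  by_cases hv : v = 0
  · exact Or.inl hv
  right
  have h0 : 0 < star v ⬝ᵥ v := by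
    refine lt_of_le_of_ne (dotProduct_star_self_nonneg v) fun h => hv ?_
    exact dotProduct_star_self_eq_zero.1 h.symm
  obtain ⟨t, ht, hte⟩ : ∃ t : ℝ, 0 < t ∧ star v ⬝ᵥ v = t := by
    obtain ⟨hre, him⟩ := Complex.lt_def.1 h0
    exact ⟨(star v ⬝ᵥ v).re, hre, Complex.ext rfl him.symm⟩
  have hs : (Real.sqrt t : ℂ) * Real.sqrt t = t := by
    rw [← Complex.ofReal_mul, Real.mul_self_sqrt ht.le]
  have hs0 : (Real.sqrt t : ℂ) ≠ 0 := by
    simpa using (Real.sqrt_pos.2 ht).ne'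
  have hstar : star ((Real.sqrt t : ℂ)⁻¹ • v) = (Real.sqrt t : ℂ)⁻¹ • star v := by
    ext i
    simp
  refine ⟨vecMulVec ((Real.sqrt t : ℂ)⁻¹ • v) (star ((Real.sqrt t : ℂ)⁻¹ • v)),
    vecMulVec_star_mem_pureStates ?_, t, ht.le, ?_⟩
  · rw [hstar, smul_dotProduct, dotProduct_smul, hte, smul_eq_mul, smul_eq_mul, ← hs]
    field_simp
  · rw [hstar, smul_vecMulVec, vecMulVec_smul, smul_smul, smul_smul, ← hs]
    field_simp
    simp

theorem vecMulVec_star_mem_span (v : Fin d → ℂ) :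
    vecMulVec v (star v) ∈ Submodule.span ℂ (pureStates d) := by
  obtain rfl | ⟨P, hP, t, -, h⟩ := vecMulVec_star_eq_smul v
  · simp
  · rw [h]
    exact Submodule.smul_mem _ _ (Submodule.subset_span hP)

/-- Polarization. -/
theorem vecMulVec_mem_span (u v : Fin d → ℂ) :
    vecMulVec u (star v) ∈ Submodule.span ℂ (pureStates d) := by
  have h : vecMulVec u (star v) = (4 : ℂ)⁻¹ • (vecMulVec (u + v) (star (u + v))
      - vecMulVec (u - v) (star (u - v))
      + Complex.I • vecMulVec (u + Complex.I • v) (star (u + Complex.I • v))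
      - Complex.I • vecMulVec (u - Complex.I • v) (star (u - Complex.I • v))) := by
    ext r c
    simp [vecMulVec_apply]
    linear_combination (1 / 2 * u r * (starRingEnd ℂ) (v c)
      - 1 / 2 * v r * (starRingEnd ℂ) (u c)) * Complex.I_sq
  rw [h]
  have hm := vecMulVec_star_mem_span (d := d)
  exact Submodule.smul_mem _ _ (Submodule.sub_mem _ (Submodule.add_mem _
    (Submodule.sub_mem _ (hm _) (hm _)) (Submodule.smul_mem _ _ (hm _)))
    (Submodule.smul_mem _ _ (hm _)))

theorem span_pureStates (d : ℕ) : Submodule.span ℂ (pureStates d) = ⊤ := by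
  refine eq_top_iff.2 fun A _ => ?_
  rw [matrix_eq_sum_single A]
  refine Submodule.sum_mem _ fun r _ => Submodule.sum_mem _ fun c _ => ?_
  have h : single r c (A r c) = vecMulVec (A r c • Pi.single r 1) (star (Pi.single c 1)) := by
    ext i j
    simp only [single, vecMulVec_apply, of_apply, Pi.smul_apply, Pi.single_apply, Pi.star_apply,
      smul_eq_mul]
    by_cases h1 : r = i <;> by_cases h2 : c = j <;> simp [h1, h2, eq_comm]
  rw [h]
  exact vecMulVec_mem_span _ _

theorem exists_isUnit_re_mul_eq_zero (s : ℂ) : ∃ c : ℂ, star c * c = 1 ∧ (c * s).re = 0 := by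
  by_cases hs : s = 0
  · exact ⟨1, by simp, by simp [hs]⟩
  have hn : (‖s‖ : ℂ) ≠ 0 := by simpa using hs
  have h : (starRingEnd ℂ) s * s = ‖s‖ * ‖s‖ := by
    rw [mul_comm, Complex.mul_conj, Complex.normSq_eq_norm_sq]
    push_cast
    ring
  refine ⟨Complex.I * (starRingEnd ℂ) s / ‖s‖, ?_, ?_⟩
  · simp only [Complex.star_def, map_div₀, map_mul, Complex.conj_I, Complex.conj_conj,
      Complex.conj_ofReal]
    field_simp
    rw [Complex.I_sq]
    linear_combination h
  · have h1 : Complex.I * (starRingEnd ℂ) s / ‖s‖ * s = Complex.I * ‖s‖ := by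
      field_simp
      linear_combination h
    simp [h1]

/-- Two distinct pure states do not exhaust the decompositions of their sum: the Bloch sphere
through them has other chords with the same midpoint. -/
theorem exists_add_eq_add {P Q : Mat d} (hP : P ∈ pureStates d) (hQ : Q ∈ pureStates d)
    (hPQ : P ≠ Q) : ∃ R ∈ pureStates d, ∃ S ∈ pureStates d, R ≠ P ∧ R ≠ Q ∧ P + Q = R + S := by
  obtain ⟨p, hp, rfl⟩ := mem_pureStates_iff.1 hP
  obtain ⟨q₀, hq₀, rfl⟩ := mem_pureStates_iff.1 hQ
  -- A phase leaves the projection on `q₀` unchanged and makes `⟨p, q⟩` imaginary, so `p + q` and `p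
  -- - q` both have squared norm 2.
  obtain ⟨c, hc, hcs⟩ := exists_isUnit_re_mul_eq_zero (star p ⬝ᵥ q₀)
  obtain ⟨q, hq, hQq, hpq⟩ : ∃ q, star q ⬝ᵥ q = 1 ∧ vecMulVec q₀ (star q₀) = vecMulVec q (star q)
      ∧ (star p ⬝ᵥ q).re = 0 := by
    refine ⟨c • q₀, ?_, ?_, ?_⟩
    · rw [star_smul, smul_dotProduct, dotProduct_smul, hq₀, smul_eq_mul, smul_eq_mul, mul_one, hc]
    · rw [star_smul, smul_vecMulVec, vecMulVec_smul, smul_smul, mul_comm c, hc, one_smul]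
    · rw [dotProduct_smul, smul_eq_mul, hcs]
  rw [hQq] at hPQ ⊢
  clear hQq hcs hc c hq₀ hQ hP q₀
  have hqp : star q ⬝ᵥ p = star (star p ⬝ᵥ q) := by
    simp [dotProduct, mul_comm]
  have hsum : star p ⬝ᵥ q + star q ⬝ᵥ p = 0 := by
    rw [hqp, Complex.star_def, Complex.add_conj, hpq]
    simp
  -- Any `z` with `|z|² = 1/2` normalizes `p ± q`; this one avoids `√2`.
  set z : ℂ := (1 + Complex.I) / 2
  have hz : star z * z = 1 / 2 := by
    simp [z]
    linear_combination -(1 / 4 : ℂ) * Complex.I_sq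
  have unit : ∀ w : Fin d → ℂ, star w ⬝ᵥ w = 2 → star (z • w) ⬝ᵥ (z • w) = 1 := fun w hw => by
    rw [star_smul, smul_dotProduct, dotProduct_smul, hw, smul_eq_mul, smul_eq_mul, ← mul_assoc, hz]
    norm_num
  have proj : ∀ w : Fin d → ℂ,
      vecMulVec (z • w) (star (z • w)) = (1 / 2 : ℂ) • vecMulVec w (star w) := fun w => by
    rw [star_smul, smul_vecMulVec, vecMulVec_smul, smul_smul, mul_comm z, hz]
  -- With `s = ⟨p, q⟩` imaginary, evaluating a coincidence at `p` gives `(1 + |s|²) / 2 = 1`. Then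
  -- `|s| = 1`, which makes the projections on `p` and `q` equal.
  have ne : ∀ p q : Fin d → ℂ, star p ⬝ᵥ p = 1 → star q ⬝ᵥ q = 1 → (star p ⬝ᵥ q).re = 0 →
      vecMulVec p (star p) ≠ vecMulVec q (star q) → star q ⬝ᵥ p = star (star p ⬝ᵥ q) →
      (1 / 2 : ℂ) • vecMulVec (p + q) (star (p + q)) ≠ vecMulVec p (star p) := by
    intro p q hp hq hpq hPQ hqp h
    refine hPQ ?_
    have h2 := congrArg (fun M => star p ⬝ᵥ (M *ᵥ p)) h
    set s := star p ⬝ᵥ q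
    simp [vecMulVec_mulVec, smul_mulVec, hp, hqp, add_dotProduct, dotProduct_add] at h2
    have h3 : (starRingEnd ℂ) s = -s := by
      apply Complex.ext <;> simp [hpq]
    rw [h3] at h2
    apply eq_of_trace_mul_eq_one (vecMulVec_star_mem_pureStates hp)
      (vecMulVec_star_mem_pureStates hq)
    rw [vecMulVec_mul_vecMulVec, vecMulVec_smul, trace_smul, trace_vecMulVec,
      dotProduct_comm p, hqp, smul_eq_mul]
    change s * (starRingEnd ℂ) s = 1
    rw [h3]
    linear_combination 2 * h2
  refine ⟨_, vecMulVec_star_mem_pureStates (unit (p + q) ?_),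
    _, vecMulVec_star_mem_pureStates (unit (p - q) ?_), ?_, ?_, ?_⟩
  · simp only [star_add, add_dotProduct, dotProduct_add, hp, hq]
    linear_combination hsum
  · simp only [star_sub, sub_dotProduct, dotProduct_sub, hp, hq]
    linear_combination -hsum
  · rw [proj]
    exact ne p q hp hq hpq hPQ hqp
  · rw [proj, add_comm]
    exact ne q p hq hp (by rw [hqp]; simpa using hpq) hPQ.symm (by rw [hqp, star_star])
  · rw [proj, proj]
    ext i j
    simp [vecMulVec_apply]
    ring

end PureStates

/-! ### Linear maps permuting pure states are Jordan homomorphisms. -/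

section Wigner

variable {d : ℕ}

theorem frame_mem_pureStates {U : Mat d} (hU : U ∈ unitaryGroup (Fin d) ℂ) (i : Fin d) :
    vecMulVec (U.col i) (star (U.col i)) ∈ pureStates d :=
  vecMulVec_star_mem_pureStates (by simp [col_dotProduct_col hU])

theorem sum_frame {U : Mat d} (hU : U ∈ unitaryGroup (Fin d) ℂ) :
    ∑ i, vecMulVec (U.col i) (star (U.col i)) = 1 := by
  rw [← mem_unitaryGroup_iff.1 hU]
  ext r c
  simp [mul_apply, vecMulVec_apply, Matrix.sum_apply, star_apply]

theorem posSemidef_of_trace_mul_nonneg {A : Mat d} (hA : A.IsHermitian)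
    (h : ∀ P ∈ pureStates d, 0 ≤ (A * P).trace) : A.PosSemidef := by
  refine PosSemidef.of_dotProduct_mulVec_nonneg hA fun v => ?_
  have h1 : star v ⬝ᵥ (A *ᵥ v) = (A * vecMulVec v (star v)).trace := by
    rw [mul_vecMulVec, trace_vecMulVec, dotProduct_comm]
  rw [h1]
  obtain rfl | ⟨P, hP, t, ht, hv⟩ := vecMulVec_star_eq_smul v
  · simp
  · rw [hv, mul_smul_comm, trace_smul]
    exact mul_nonneg (by exact_mod_cast ht) (h P hP)

theorem ext_of_pureStates {E : Type*} [AddCommMonoid E] [Module ℂ E] {f g : Mat d →ₗ[ℂ] E}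
    (h : ∀ P ∈ pureStates d, f P = g P) : f = g :=
  LinearMap.ext_on (span_pureStates d) fun P hP => h P hP

theorem isHermitian_map {ψ : Mat d →ₗ[ℂ] Mat d} (hψ : ∀ P ∈ pureStates d, ψ P ∈ pureStates d)
    {A : Mat d} (hA : A.IsHermitian) : (ψ A).IsHermitian := by
  obtain ⟨U, hU, h⟩ := exists_unitary_eq_sum hA
  rw [h, map_sum, IsHermitian, conjTranspose_sum]
  refine Finset.sum_congr rfl fun i _ => ?_
  rw [map_smul, conjTranspose_smul, (hψ _ (frame_mem_pureStates hU i)).1.eq]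
  simp

theorem map_conjTranspose {ψ : Mat d →ₗ[ℂ] Mat d} (hψ : ∀ P ∈ pureStates d, ψ P ∈ pureStates d)
    (A : Mat d) : ψ Aᴴ = (ψ A)ᴴ := by
  obtain ⟨H, K, hH, hK, rfl⟩ : ∃ H K : Mat d, H.IsHermitian ∧ K.IsHermitian ∧
      A = H + Complex.I • K := by
    refine ⟨(1 / 2 : ℂ) • (A + Aᴴ), (-Complex.I / 2) • (A - Aᴴ), ?_, ?_, ?_⟩
    · ext i j
      simp
      ring
    · ext i j
      simp
      ring
    · ext i j
      simp
      linear_combination (1 / 2 * (A i j - (starRingEnd ℂ) (A j i))) * Complex.I_sq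
  have h1 := (isHermitian_map hψ hH).eq
  have h2 := (isHermitian_map hψ hK).eq
  simp [hH.eq, hK.eq, h1, h2]

theorem trace_map {ψ : Mat d →ₗ[ℂ] Mat d} (hψ : ∀ P ∈ pureStates d, ψ P ∈ pureStates d)
    (A : Mat d) : (ψ A).trace = A.trace := by
  have h : (traceLinearMap (Fin d) ℂ ℂ) ∘ₗ ψ = traceLinearMap (Fin d) ℂ ℂ :=
    ext_of_pureStates fun P hP => by simp [(hψ P hP).2.2, hP.2.2]
  exact LinearMap.congr_fun h A

theorem trace_map_mul_nonneg {ψ : Mat d →ₗ[ℂ] Mat d}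
    (hψ : ∀ P ∈ pureStates d, ψ P ∈ pureStates d) {A : Mat d} (hA : A.PosSemidef) {Q : Mat d}
    (hQ : Q ∈ pureStates d) : 0 ≤ (ψ A * Q).trace := by
  obtain ⟨U, hU, h⟩ := exists_unitary_eq_sum hA.1
  rw [h, map_sum, Matrix.sum_mul, trace_sum]
  refine Finset.sum_nonneg fun i _ => ?_
  obtain ⟨t, ht, -, hte⟩ :=
    trace_mul_of_mem_pureStates (hψ _ (frame_mem_pureStates hU i)) hQ
  rw [map_smul, smul_mul, trace_smul, hte, smul_eq_mul]
  have := hA.eigenvalues_nonneg i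
  exact_mod_cast mul_nonneg this ht

theorem posSemidef_one_sub {P : Mat d} (hP : P ∈ pureStates d) : (1 - P).PosSemidef := by
  have h : 1 - P = (1 - P)ᴴ * (1 - P) := by
    rw [conjTranspose_sub, conjTranspose_one, hP.1.eq, mul_sub, sub_mul, sub_mul,
      mul_self_of_mem_pureStates hP]
    simp
  rw [h]
  exact posSemidef_conjTranspose_mul_self _

/-- For a pure state `Q = ψ P`, positivity of `1 - P` gives `tr (ψ(1) Q) ≥ tr (Q Q) = 1`. Hence `ψ 1
- 1` is positive, and it has trace zero. -/
theorem map_one_of_image_pureStates {ψ : Mat d →ₗ[ℂ] Mat d} (hψ : ψ '' pureStates d = pureStates d) :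
    ψ 1 = 1 := by
  have hmem : ∀ P ∈ pureStates d, ψ P ∈ pureStates d := fun P hP =>
    hψ ▸ Set.mem_image_of_mem ψ hP
  have hpos : (ψ 1 - 1).PosSemidef := by
    refine posSemidef_of_trace_mul_nonneg
      ((isHermitian_map hmem isHermitian_one).sub isHermitian_one) fun Q hQ => ?_
    obtain ⟨P, hP, rfl⟩ : Q ∈ ψ '' pureStates d := by rwa [hψ]
    have h := trace_map_mul_nonneg hmem (posSemidef_one_sub hP) hQ
    rw [map_sub, sub_mul, trace_sub, trace_mul_self_of_mem_pureStates hQ] at h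
    rwa [sub_mul, trace_sub, one_mul, hQ.2.2]
  refine sub_eq_zero.1 (hpos.trace_eq_zero_iff.1 ?_)
  rw [trace_sub, trace_map hmem, sub_self]

/-- The images of a frame sum to `ψ 1 = 1`, so the overlaps of the `i`-th image with all of them sum
to 1. Its overlap with itself is already 1, and the others are nonnegative. -/
theorem map_frame_mul_map_frame {ψ : Mat d →ₗ[ℂ] Mat d} (hψ : ψ '' pureStates d = pureStates d)
    {U : Mat d} (hU : U ∈ unitaryGroup (Fin d) ℂ) {i j : Fin d} (hij : i ≠ j) :
    ψ (vecMulVec (U.col i) (star (U.col i))) * ψ (vecMulVec (U.col j) (star (U.col j))) = 0 := by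
  have hmem : ∀ i, ψ (vecMulVec (U.col i) (star (U.col i))) ∈ pureStates d := fun i =>
    hψ ▸ Set.mem_image_of_mem ψ (frame_mem_pureStates hU i)
  choose t ht0 _ ht using fun j => trace_mul_of_mem_pureStates (hmem i) (hmem j)
  have hsum : ∑ j, (t j : ℂ) = 1 := by
    simp only [← ht]
    rw [← trace_sum, ← Matrix.mul_sum, ← map_sum, sum_frame hU, map_one_of_image_pureStates hψ,
      mul_one, (hmem i).2.2]
  have hi : t i = 1 := by
    have h := ht i
    rw [trace_mul_self_of_mem_pureStates (hmem i)] at h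
    exact_mod_cast h.symm
  have hsum' : ∑ j, t j = 1 := by exact_mod_cast hsum
  rw [← Finset.add_sum_erase _ _ (Finset.mem_univ i), hi] at hsum'
  have h0 := (Finset.sum_eq_zero_iff_of_nonneg fun j _ => ht0 j).1 (by linarith) j
    (Finset.mem_erase.2 ⟨hij.symm, Finset.mem_univ j⟩)
  exact mul_eq_zero_of_trace_mul_eq_zero (hmem i) (hmem j) (by rw [ht, h0, Complex.ofReal_zero])

theorem frame_mul_frame {U : Mat d} (hU : U ∈ unitaryGroup (Fin d) ℂ) {i j : Fin d} (hij : i ≠ j) :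
    vecMulVec (U.col i) (star (U.col i)) * vecMulVec (U.col j) (star (U.col j)) = 0 :=
  map_frame_mul_map_frame (ψ := LinearMap.id) (by simp) hU hij

theorem sum_smul_mul_self {Q : Fin d → Mat d} (hQ : ∀ i, Q i * Q i = Q i)
    (hne : ∀ i j, i ≠ j → Q i * Q j = 0) (c : Fin d → ℂ) :
    (∑ i, c i • Q i) * (∑ i, c i • Q i) = ∑ i, (c i * c i) • Q i := by
  rw [Matrix.sum_mul]
  refine Finset.sum_congr rfl fun i _ => ?_
  rw [Matrix.mul_sum, Finset.sum_eq_single i]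
  · rw [smul_mul_smul_comm, hQ]
  · intro j _ hj
    rw [smul_mul_smul_comm, hne i j hj.symm, smul_zero]
  · simp

/-- In a spectral decomposition, `ψ` sends orthogonal projections to orthogonal projections with the
same eigenvalues. -/
theorem map_mul_self_of_isHermitian {ψ : Mat d →ₗ[ℂ] Mat d}
    (hψ : ψ '' pureStates d = pureStates d) {A : Mat d} (hA : A.IsHermitian) :
    ψ (A * A) = ψ A * ψ A := by
  obtain ⟨U, hU, h⟩ := exists_unitary_eq_sum hA
  have hmem : ∀ i, ψ (vecMulVec (U.col i) (star (U.col i))) ∈ pureStates d := fun i =>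
    hψ ▸ Set.mem_image_of_mem ψ (frame_mem_pureStates hU i)
  rw [h, sum_smul_mul_self (fun i => mul_self_of_mem_pureStates (frame_mem_pureStates hU i))
    (fun i j => frame_mul_frame hU)]
  simp only [map_sum, map_smul]
  rw [sum_smul_mul_self (fun i => mul_self_of_mem_pureStates (hmem i))
    (fun i j => map_frame_mul_map_frame hψ hU)]

theorem map_jordan_of_isHermitian {ψ : Mat d →ₗ[ℂ] Mat d}
    (hψ : ψ '' pureStates d = pureStates d) {A B : Mat d} (hA : A.IsHermitian)
    (hB : B.IsHermitian) : ψ (A * B + B * A) = ψ A * ψ B + ψ B * ψ A := by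
  have h := map_mul_self_of_isHermitian hψ (hA.add hB)
  have e : A * B + B * A = (A + B) * (A + B) - A * A - B * B := by noncomm_ring
  rw [e, map_sub, map_sub, h, map_mul_self_of_isHermitian hψ hA,
    map_mul_self_of_isHermitian hψ hB, map_add]
  noncomm_ring

/-- A linear map permuting the pure states is a Jordan homomorphism. -/
theorem map_jordan {ψ : Mat d →ₗ[ℂ] Mat d} (hψ : ψ '' pureStates d = pureStates d) (A B : Mat d) :
    ψ (A * B + B * A) = ψ A * ψ B + ψ B * ψ A := by
  have aux : ∀ P ∈ pureStates d, ∀ B, ψ (P * B + B * P) = ψ P * ψ B + ψ B * ψ P := by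
    intro P hP B
    have h : ψ ∘ₗ (LinearMap.mulLeft ℂ P + LinearMap.mulRight ℂ P) =
        (LinearMap.mulLeft ℂ (ψ P) + LinearMap.mulRight ℂ (ψ P)) ∘ₗ ψ :=
      ext_of_pureStates fun Q hQ => by simpa using map_jordan_of_isHermitian hψ hP.1 hQ.1
    simpa using LinearMap.congr_fun h B
  have h : ψ ∘ₗ (LinearMap.mulRight ℂ B + LinearMap.mulLeft ℂ B) =
      (LinearMap.mulRight ℂ (ψ B) + LinearMap.mulLeft ℂ (ψ B)) ∘ₗ ψ :=
    ext_of_pureStates fun P hP => by simpa using aux P hP B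
  simpa using LinearMap.congr_fun h A

end Wigner

/-! ### Jordan *-homomorphisms fixing the diagonal matrix units. -/

section JordanNormalForm

variable {d : ℕ} {χ : Mat d →ₗ[ℂ] Mat d}

/-- Row `o` determines `χ`: the adjoint gives column `o`, and the Jordan product of `E_io` and
`E_oj` gives `E_ij` the factor `conj (c i) * c j`. For `i = j` it forces `|c j| = 1`. -/
theorem exists_diagonal_form (hJ : ∀ A B, χ (A * B + B * A) = χ A * χ B + χ B * χ A)
    (hS : ∀ A, χ Aᴴ = (χ A)ᴴ) (hE : ∀ i, χ (single i i 1) = single i i 1)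
    {o : Fin d} {c : Fin d → ℂ} (hc : ∀ j, χ (single o j 1) = c j • single o j 1) :
    ∃ U ∈ unitaryGroup (Fin d) ℂ, ∀ X, χ X = U * X * Uᴴ := by
  have hco : c o = 1 := by
    have h := congrFun (congrFun ((hc o).symm.trans (hE o)) o) o
    simpa using h
  have hc' : ∀ i, χ (single i o 1) = star (c i) • single i o 1 := fun i => by
    have h := hS (single o i 1)
    rwa [conjTranspose_single, star_one, hc, conjTranspose_smul, conjTranspose_single,
      star_one] at h
  have hne : ∀ i j, i ≠ j → χ (single i j 1) = (star (c i) * c j) • single i j 1 := by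
    intro i j hij
    by_cases hi : i = o
    · rw [hi, hc, hco, star_one, one_mul]
    have h := hJ (single i o 1) (single o j 1)
    rw [single_mul_single_same, single_mul_single_of_ne _ _ _ _ hij.symm, hc, hc',
      smul_mul_smul_comm, smul_mul_smul_comm, single_mul_single_same,
      single_mul_single_of_ne _ _ _ _ hij.symm] at h
    simpa using h
  have hcn : ∀ j, star (c j) * c j = 1 := by
    intro j
    by_cases hj : j = o
    · rw [hj, hco, star_one, one_mul]
    have h := hJ (single o j 1) (single j o 1)
    rw [single_mul_single_same, single_mul_single_same, hc, hc', map_add, mul_one, hE, hE,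
      smul_mul_smul_comm, smul_mul_smul_comm, single_mul_single_same,
      single_mul_single_same] at h
    have h1 := congrFun (congrFun h j) j
    simpa [single_apply, Ne.symm hj] using h1.symm
  have hall : ∀ i j, χ (single i j 1) = (star (c i) * c j) • single i j 1 := by
    intro i j
    by_cases hij : i = j
    · rw [hij, hE, hcn, one_smul]
    · exact hne i j hij
  refine ⟨diagonal fun i => star (c i), ?_, fun X => ?_⟩
  · rw [mem_unitaryGroup_iff, star_eq_conjTranspose, diagonal_conjTranspose, diagonal_mul_diagonal,
      ← diagonal_one]
    congr 1
    ext i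
    simpa using hcn i
  · conv_lhs => rw [matrix_eq_sum_single X]
    have hs : ∀ r c, single r c (X r c) = X r c • single r c (1 : ℂ) := fun r c => by simp
    simp only [hs, map_sum, map_smul, hall]
    ext r s
    rw [diagonal_conjTranspose, mul_diagonal, diagonal_mul]
    simp [Matrix.sum_apply, single_apply]
    rw [Finset.sum_eq_single r (fun i _ hi => by simp [hi]) (by simp),
      Finset.sum_eq_single s (fun i _ hi => by simp [hi]) (by simp)]
    simp
    ring

/-- `E_ij` is its own Jordan product with `E_ii` and with `E_jj`. At a nonzero entry of the image,
exactly one of the two indices is therefore `i`, and exactly one is `j`. -/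
theorem map_corner (hJ : ∀ A B, χ (A * B + B * A) = χ A * χ B + χ B * χ A)
    (hE : ∀ i, χ (single i i 1) = single i i 1) {i j : Fin d} (hij : i ≠ j) :
    χ (single i j 1) =
      χ (single i j 1) i j • single i j 1 + χ (single i j 1) j i • single j i 1 := by
  have h1 := hJ (single i i 1) (single i j 1)
  have h2 := hJ (single i j 1) (single j j 1)
  rw [single_mul_single_same, single_mul_single_of_ne _ _ _ _ hij.symm, mul_one, add_zero,
    hE] at h1 h2
  set M := χ (single i j 1)
  ext r s
  have hl : ∀ l, (single l l (1 : ℂ) * M) r s = if l = r then M l s else 0 := fun l => by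
    split_ifs with h
    · subst h
      simp
    · simp [Ne.symm h]
  have hr : ∀ l, (M * single l l (1 : ℂ)) r s = if l = s then M r l else 0 := fun l => by
    split_ifs with h
    · subst h
      simp
    · simp [Ne.symm h]
  have e1 := congrFun (congrFun h1 r) s
  have e2 := congrFun (congrFun h2 r) s
  simp only [Matrix.add_apply, Matrix.smul_apply, single_apply, hl, hr, smul_eq_mul] at e1 e2 ⊢
  clear h1 h2 hl hr hJ hE
  clear_value M
  grind

theorem isStandard_of_jordan (hJ : ∀ A B, χ (A * B + B * A) = χ A * χ B + χ B * χ A)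
    (hS : ∀ A, χ Aᴴ = (χ A)ᴴ) (hE : ∀ i, χ (single i i 1) = single i i 1) : IsStandard χ := by
  obtain rfl | ⟨o, -⟩ : d = 0 ∨ ∃ o : Fin d, True := by
    rcases d with _ | d
    · exact Or.inl rfl
    · exact Or.inr ⟨0, trivial⟩
  · exact ⟨1, one_mem _, Or.inl fun X => Subsingleton.elim _ _⟩
  set a : Fin d → ℂ := fun j => χ (single o j 1) o j
  set b : Fin d → ℂ := fun j => χ (single o j 1) j o
  have hab : ∀ j, o ≠ j → χ (single o j 1) = a j • single o j 1 + b j • single j o 1 :=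
    fun j hj => map_corner hJ hE hj
  -- The Jordan product of `E_oi` and `E_oj` vanishes. It follows that either all `b` vanish, or all
  -- `a` do; the latter case becomes the former after a transposition.
  have hmul : ∀ i j, o ≠ i → o ≠ j → b i * a j = 0 := by
    intro i j hi hj
    have h := hJ (single o i 1) (single o j 1)
    rw [single_mul_single_of_ne _ _ _ _ hi.symm, single_mul_single_of_ne _ _ _ _ hj.symm,
      add_zero, map_zero, hab i hi, hab j hj] at h
    have h1 := congrFun (congrFun h i) j
    by_cases hij : i = j
    · subst hij
      simp [add_mul, mul_add, single_mul_single_of_ne _ _ _ _ hi.symm,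
        single_mul_single_of_ne _ _ _ _ hi, hi] at h1
      linear_combination -(1 / 2 : ℂ) * h1
    · simp [add_mul, mul_add, single_mul_single_of_ne _ _ _ _ hi.symm,
        single_mul_single_of_ne _ _ _ _ hj.symm, single_mul_single_of_ne _ _ _ _ hi,
        single_mul_single_of_ne _ _ _ _ hj, single_mul_single_of_ne _ _ _ _ hij,
        single_mul_single_of_ne _ _ _ _ (Ne.symm hij), hij, Ne.symm hij] at h1
      simpa [or_comm] using h1
  by_cases hb : ∀ j, o ≠ j → b j = 0
  · obtain ⟨U, hU, h⟩ := exists_diagonal_form hJ hS hE (o := o) (c := Function.update a o 1)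
      fun j => by
        by_cases hj : j = o
        · simp [hj, hE]
        · rw [hab j (Ne.symm hj), hb j (Ne.symm hj), Function.update_of_ne hj, zero_smul, add_zero]
    exact ⟨U, hU, Or.inl h⟩
  · push Not at hb
    obtain ⟨i, hi, hbi⟩ := hb
    have ha : ∀ j, o ≠ j → a j = 0 := fun j hj =>
      (mul_eq_zero.1 (hmul i j hi hj)).resolve_left hbi
    obtain ⟨U, hU, h⟩ := exists_diagonal_form
      (χ := χ ∘ₗ (transposeLinearEquiv (Fin d) (Fin d) ℂ ℂ).toLinearMap)
      (fun A B => by simp [← hJ, add_comm]) (fun A => by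
        simpa [← hS] using congrArg χ (by ext; simp)) (fun i => by simp [hE]) (o := o)
      (c := Function.update (fun j => star (b j)) o 1)
      fun j => by
        by_cases hj : j = o
        · simp [hj, hE]
        · have h := hS (single o j 1)
          rw [hab j (Ne.symm hj), ha j (Ne.symm hj)] at h
          simpa [hj] using h
    refine ⟨U, hU, Or.inr fun X => ?_⟩
    simpa using h Xᵀ

end JordanNormalForm

theorem vecMulVec_col_one {d : ℕ} (i : Fin d) :
    vecMulVec ((1 : Mat d).col i) (star ((1 : Mat d).col i)) = single i i 1 := by
  ext r s
  by_cases hr : i = r <;> by_cases hs : i = s <;>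
    simp [vecMulVec_apply, single_apply, one_apply, hr, hs, eq_comm]

/-- Wigner's theorem for linear maps: a linear map permuting the pure states is implemented by a
unitary, possibly after a transposition. -/
theorem isStandard_of_image_pureStates {d : ℕ} {ψ : Mat d →ₗ[ℂ] Mat d}
    (hψ : ψ '' pureStates d = pureStates d) : IsStandard ψ := by
  have hmem : ∀ P ∈ pureStates d, ψ P ∈ pureStates d := fun P hP =>
    hψ ▸ Set.mem_image_of_mem ψ hP
  have hQ : ∀ i : Fin d, ψ (single i i 1) ∈ pureStates d := fun i => by
    rw [← vecMulVec_col_one]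
    exact hmem _ (frame_mem_pureStates (one_mem _) i)
  have hQQ : ∀ i j : Fin d, i ≠ j → ψ (single i i 1) * ψ (single j j 1) = 0 := fun i j hij => by
    rw [← vecMulVec_col_one, ← vecMulVec_col_one]
    exact map_frame_mul_map_frame hψ (one_mem _) hij
  choose v hv hvQ using fun i => mem_pureStates_iff.1 (hQ i)
  -- The columns of `V` are orthonormal vectors spanning the images of the `E_ii`, so conjugating
  -- back by `V` reduces to a map that fixes every `E_ii`.
  set V : Mat d := of fun r c => v c r
  have hcol : ∀ i, V.col i = v i := fun i => rfl
  have hVV : Vᴴ * V = 1 := by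
    ext i j
    have h1 : (Vᴴ * V) i j = star (v i) ⬝ᵥ v j := by
      simp [V, mul_apply, dotProduct]
    rw [h1, one_apply]
    split_ifs with hij
    · rw [← hij, hv]
    · have h := hQQ i j hij
      rw [hvQ, hvQ, vecMulVec_mul_vecMulVec, vecMulVec_smul, smul_eq_zero] at h
      refine h.resolve_right (vecMulVec_ne_zero ?_ (star_ne_zero.2 ?_))
      · rintro h0
        simpa [h0] using hv i
      · rintro h0
        simpa [h0] using hv j
  have hVV' : V * Vᴴ = 1 := mul_eq_one_comm.1 hVV
  have hVE : ∀ i, V * single i i 1 * Vᴴ = ψ (single i i 1) := fun i => by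
    rw [hvQ, ← vecMulVec_col_one, mul_vecMulVec, vecMulVec_mul]
    have h : V *ᵥ (1 : Mat d).col i = v i := by
      ext r
      simp [V, mulVec, dotProduct, one_apply]
    rw [h]
    congr 1
    rw [← h, star_mulVec]
  obtain ⟨U, hU, h⟩ := isStandard_of_jordan
    (χ := LinearMap.mulLeft ℂ Vᴴ ∘ₗ LinearMap.mulRight ℂ V ∘ₗ ψ) (fun A B => by
      have e : ∀ A B : Mat d, Vᴴ * (A * B * V) = Vᴴ * (A * V) * (Vᴴ * (B * V)) := fun A B => by
        calc Vᴴ * (A * B * V) = Vᴴ * (A * 1 * B * V) := by rw [mul_one]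
          _ = _ := by rw [← hVV']; simp only [Matrix.mul_assoc]
      simp only [LinearMap.comp_apply, LinearMap.mulLeft_apply, LinearMap.mulRight_apply,
        map_jordan hψ, add_mul, mul_add, e]) (fun A => by
      simp [map_conjTranspose hmem, Matrix.mul_assoc]) (fun i => by
      simp only [LinearMap.comp_apply, LinearMap.mulLeft_apply, LinearMap.mulRight_apply, ← hVE]
      rw [Matrix.mul_assoc, hVV, mul_one, ← Matrix.mul_assoc, hVV, one_mul])
  have hback : ∀ X, ψ X = V * (Vᴴ * (ψ X * V)) * Vᴴ := fun X => by
    rw [← Matrix.mul_assoc V, hVV', one_mul, Matrix.mul_assoc, hVV', mul_one]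
  simp only [LinearMap.comp_apply, LinearMap.mulLeft_apply, LinearMap.mulRight_apply] at h
  refine ⟨V * U, mul_mem (mem_unitaryGroup_iff.2 hVV') hU, h.imp (fun h X => ?_) fun h X => ?_⟩
  all_goals
    rw [hback, h, conjTranspose_mul]
    simp only [Matrix.mul_assoc]

/-! ### Automorphisms of Hamming graphs. -/

section Hamming

variable {ι : Type*} {X : ι → Type*}

/-- The points `x` and `y` of a product differ in the coordinate `i` and nowhere else. -/
def DifferOnlyAt (x y : ∀ i, X i) (i : ι) : Prop :=
  x i ≠ y i ∧ ∀ j, j ≠ i → x j = y j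

theorem DifferOnlyAt.symm {x y : ∀ i, X i} {i : ι} (h : DifferOnlyAt x y i) :
    DifferOnlyAt y x i :=
  ⟨h.1.symm, fun j hj => (h.2 j hj).symm⟩

theorem DifferOnlyAt.eq_of_ne {x y : ∀ i, X i} {i j : ι} (h : DifferOnlyAt x y i)
    (hj : x j ≠ y j) : j = i := by
  by_contra hji
  exact hj (h.2 j hji)

variable [DecidableEq ι]

theorem differOnlyAt_update {x : ∀ i, X i} {i : ι} {t : X i} (ht : t ≠ x i) :
    DifferOnlyAt x (Function.update x i t) i :=
  ⟨by simpa using ht.symm, fun j hj => by simp [hj]⟩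

theorem DifferOnlyAt.update_eq {x y : ∀ i, X i} {i : ι} (h : DifferOnlyAt x y i) :
    Function.update x i (y i) = y := by
  ext j
  by_cases hj : j = i
  · subst hj
    simp
  · simp [hj, h.2 j hj]

/-- A function that ignores every coordinate in `s` depends only on the others. -/
theorem eq_of_forall_update_eq {E : Type*} (g : (∀ i, X i) → E) (s : Finset ι)
    (h : ∀ i ∈ s, ∀ x t, g (Function.update x i t) = g x) :
    ∀ x y : ∀ i, X i, (∀ i, i ∉ s → x i = y i) → g x = g y := by
  induction s using Finset.induction_on with
  | empty =>
    intro x y hxy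
    rw [funext fun i => hxy i (Finset.notMem_empty i)]
  | insert a s has ih =>
    intro x y hxy
    rw [← h a (Finset.mem_insert_self a s) x (y a)]
    refine ih (fun i hi => h i (Finset.mem_insert_of_mem hi)) _ _ fun i hi => ?_
    by_cases hia : i = a
    · subst hia
      simp
    · rw [Function.update_of_ne hia]
      exact hxy i (by simp [hia, hi])

variable [Fintype ι] [∀ i, Nontrivial (X i)] {f : (∀ i, X i) → (∀ i, X i)}

/-- An automorphism of a Hamming graph permutes the coordinates and acts on each of them
separately. -/
theorem exists_perm_of_differOnlyAt_iff (hf : Function.Injective f)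
    (h : ∀ x y, (∃ i, DifferOnlyAt x y i) ↔ ∃ i, DifferOnlyAt (f x) (f y) i) :
    ∃ π : Equiv.Perm ι, ∀ x y i, x (π i) = y (π i) → f x i = f y i := by
  -- Two neighbours of `x` in one direction are equal or adjacent, whereas neighbours in different
  -- directions are neither. Hence `f` carries directions at `x` to directions at `f x`.
  have same : ∀ {x y z i a b}, DifferOnlyAt x y i → DifferOnlyAt x z i →
      DifferOnlyAt (f x) (f y) a → DifferOnlyAt (f x) (f z) b → a = b := by
    intro x y z i a b hy hz ha hb
    by_contra hab
    by_cases hyz : y i = z i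
    · have : y = z := by rw [← hy.update_eq, ← hz.update_eq, hyz]
      subst this
      exact hab (hb.eq_of_ne ha.1)
    · obtain ⟨c, hc⟩ := (h y z).1 ⟨i, hyz, fun j hj => (hy.2 j hj).symm.trans (hz.2 j hj)⟩
      have h1 : a = c := hc.eq_of_ne (by rw [← hb.2 a hab]; exact ha.1.symm)
      have h2 : b = c := hc.eq_of_ne (by rw [← ha.2 b (Ne.symm hab)]; exact hb.1)
      exact hab (h1.trans h2.symm)
  have diff : ∀ {x y z i j a}, i ≠ j → DifferOnlyAt x y i → DifferOnlyAt x z j →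
      DifferOnlyAt (f x) (f y) a → DifferOnlyAt (f x) (f z) a → False := by
    intro x y z i j a hij hy hz ha hb
    have hi : y i ≠ z i := by rw [← hz.2 i hij]; exact hy.1.symm
    have hj : y j ≠ z j := by rw [← hy.2 j hij.symm]; exact hz.1
    by_cases hfa : f y a = f z a
    · have : f y = f z := by rw [← ha.update_eq, ← hb.update_eq, hfa]
      exact hi (congrFun (hf this) i)
    · obtain ⟨c, hc⟩ := (h y z).2 ⟨a, hfa, fun j hj => (ha.2 j hj).symm.trans (hb.2 j hj)⟩
      exact hij ((hc.eq_of_ne hi).trans (hc.eq_of_ne hj).symm)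
  have hσ : ∀ x i, ∃ a, ∀ y, DifferOnlyAt x y i → DifferOnlyAt (f x) (f y) a := by
    intro x i
    obtain ⟨t, ht⟩ := exists_ne (x i)
    obtain ⟨a, ha⟩ := (h x _).1 ⟨i, differOnlyAt_update ht⟩
    refine ⟨a, fun y hy => ?_⟩
    obtain ⟨b, hb⟩ := (h x y).1 ⟨i, hy⟩
    rwa [same (differOnlyAt_update ht) hy ha hb]
  choose σ hσ using hσ
  have hinj : ∀ x, Function.Injective (σ x) := by
    intro x i j hij
    by_contra hne
    obtain ⟨t, ht⟩ := exists_ne (x i)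
    obtain ⟨u, hu⟩ := exists_ne (x j)
    have h1 := hσ x i _ (differOnlyAt_update ht)
    rw [hij] at h1
    exact diff hne (differOnlyAt_update ht) (differOnlyAt_update hu) h1
      (hσ x j _ (differOnlyAt_update hu))
  -- For `j ≠ i`, move both ends of the edge `x y` in direction `j`. The moved points are adjacent;
  -- if `σ x j ≠ σ y j`, their images would differ in both of these coordinates.
  have hstep : ∀ x y i, DifferOnlyAt x y i → σ x = σ y := by
    intro x y i hxy
    have h1 := hσ x i y hxy
    have hi : σ x i = σ y i := (hσ y i x hxy.symm).symm.eq_of_ne h1.1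
    ext j
    by_cases hj : j = i
    · rw [hj, hi]
    obtain ⟨t, ht⟩ := exists_ne (x j)
    have h2 := hσ x j _ (differOnlyAt_update ht)
    have ht' : t ≠ y j := by rwa [← hxy.2 j hj]
    have h3 := hσ y j _ (differOnlyAt_update ht')
    obtain ⟨c, hc⟩ := (h (Function.update x j t) (Function.update y j t)).1 ⟨i, by
      rw [Function.update_of_ne (Ne.symm hj), Function.update_of_ne (Ne.symm hj)]
      exact hxy.1, fun l hl => by
      by_cases hlj : l = j
      · subst hlj
        simp
      · rw [Function.update_of_ne hlj, Function.update_of_ne hlj]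
        exact hxy.2 l hl⟩
    by_contra hne
    have hji : σ x j ≠ σ x i := fun e => hj (hinj x e)
    have hji' : σ y j ≠ σ x i := fun e => hj (hinj y (e.trans hi))
    have e1 : σ x j = c := hc.eq_of_ne (by
      rw [← h3.2 _ hne, ← h1.2 _ hji]
      exact h2.1.symm)
    have e2 : σ y j = c := hc.eq_of_ne (by
      rw [← h2.2 _ (Ne.symm hne), h1.2 _ hji']
      exact h3.1)
    exact hne (e1.trans e2.symm)
  have hconst : ∀ x y, σ x = σ y := fun x y => by
    refine eq_of_forall_update_eq σ Finset.univ (fun i _ x t => ?_) x y (by simp)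
    by_cases ht : t = x i
    · rw [ht, Function.update_eq_self]
    · exact (hstep _ _ _ (differOnlyAt_update ht)).symm
  have x₀ : ∀ i, X i := fun i => Classical.arbitrary _
  set e : Equiv.Perm ι := Equiv.ofBijective (σ x₀) (Finite.injective_iff_bijective.1 (hinj x₀))
  have he : ∀ x i, σ x i = e i := fun x i => congrFun (hconst x x₀) i
  refine ⟨e.symm, fun x y i hxy => ?_⟩
  refine eq_of_forall_update_eq (fun x => f x i) (Finset.univ.erase (e.symm i))
    (fun j hj x t => ?_) x y fun j hj => ?_
  · have hne : j ≠ e.symm i := (Finset.mem_erase.1 hj).1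
    by_cases ht : t = x j
    · rw [ht, Function.update_eq_self]
    · have h1 := hσ x j _ (differOnlyAt_update ht)
      refine (h1.2 i fun e' => hne ?_).symm
      rw [e', he, Equiv.symm_apply_apply]
  · have : j = e.symm i := by simpa using hj
    rwa [this]

end Hamming

/-- Span induction in one slot at a time; `t` below collects the slots whose entries are still
arbitrary. -/
theorem multilinearMap_apply_mem_span {R ι N : Type*} [CommSemiring R] [Fintype ι] [DecidableEq ι]
    {M : ι → Type*} [∀ i, AddCommMonoid (M i)] [∀ i, Module R (M i)] [AddCommMonoid N] [Module R N]
    (f : MultilinearMap R M N) {s : ∀ i, Set (M i)} (hs : ∀ i, Submodule.span R (s i) = ⊤)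
    (m : ∀ i, M i) : f m ∈ Submodule.span R (f '' {x | ∀ i, x i ∈ s i}) := by
  have key : ∀ t : Finset ι, ∀ m : ∀ i, M i, (∀ i, i ∉ t → m i ∈ s i) →
      f m ∈ Submodule.span R (f '' {x | ∀ i, x i ∈ s i}) := by
    intro t
    induction t using Finset.induction_on with
    | empty =>
      exact fun m hm => Submodule.subset_span ⟨m, fun i => hm i (Finset.notMem_empty i), rfl⟩
    | insert a t ha ih =>
      intro m hm
      have h : ∀ x : M a, f (Function.update m a x) ∈
          Submodule.span R (f '' {x | ∀ i, x i ∈ s i}) := by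
        intro x
        have hx : x ∈ Submodule.span R (s a) := hs a ▸ Submodule.mem_top
        induction hx using Submodule.span_induction with
        | mem x hx =>
          refine ih _ fun i hi => ?_
          by_cases hia : i = a
          · subst hia
            simpa using hx
          · rw [Function.update_of_ne hia]
            exact hm i (by simp [hia, hi])
        | zero =>
          rw [f.map_update_zero]
          exact Submodule.zero_mem _
        | add x y _ _ hx hy =>
          rw [f.map_update_add]
          exact Submodule.add_mem _ hx hy
        | smul c x _ hx =>
          rw [f.map_update_smul]
          exact Submodule.smul_mem _ _ hx
      have := h (m a)
      rwa [Function.update_eq_self] at this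
  exact key Finset.univ m (by simp)

/-! ### Product states, partial traces and decompositions of sums. -/

section Tensor

variable {k : ℕ} {n : Fin k → ℕ}

/-- The Kronecker product as a multilinear map. -/
def tensorMultilinear (n : Fin k → ℕ) : MultilinearMap ℂ (fun i => Mat (n i)) (MultiMat n) :=
  MultilinearMap.mk' tensor
    (fun A i X Y => by
      ext r c
      have h := ((MultilinearMap.mkPiAlgebra ℂ (Fin k) ℂ).compLinearMap
        fun i => entryLinearMap ℂ ℂ (r i) (c i)).map_update_add A i X Y
      exact h)
    (fun A i a X => by
      ext r c
      have h := ((MultilinearMap.mkPiAlgebra ℂ (Fin k) ℂ).compLinearMap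
        fun i => entryLinearMap ℂ ℂ (r i) (c i)).map_update_smul A i a X
      exact h)

@[simp]
theorem tensorMultilinear_apply (A : ∀ i, Mat (n i)) : tensorMultilinear n A = tensor A :=
  rfl

theorem tensor_mul_tensor (A B : ∀ i, Mat (n i)) :
    tensor A * tensor B = tensor fun i => A i * B i := by
  ext r c
  simp only [tensor, mul_apply, of_apply, Finset.prod_univ_sum, Fintype.piFinset_univ,
    Finset.prod_mul_distrib]

theorem trace_tensor (A : ∀ i, Mat (n i)) : (tensor A).trace = ∏ i, (A i).trace := by
  simp only [tensor, trace, diag_apply, of_apply, Finset.prod_univ_sum, Fintype.piFinset_univ]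

theorem trace_tensor_mul_tensor (A B : ∀ i, Mat (n i)) :
    (tensor A * tensor B).trace = ∏ i, (A i * B i).trace := by
  rw [tensor_mul_tensor, trace_tensor]

theorem conjTranspose_tensor (A : ∀ i, Mat (n i)) : (tensor A)ᴴ = tensor fun i => (A i)ᴴ := by
  ext r c
  simp [tensor]

theorem span_productPureStates (n : Fin k → ℕ) :
    Submodule.span ℂ (productPureStates n) = ⊤ := by
  have hT : ∀ A : ∀ i, Mat (n i), tensor A ∈ Submodule.span ℂ (productPureStates n) := fun A => by
    refine Submodule.span_mono ?_ (multilinearMap_apply_mem_span (tensorMultilinear n)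
      (fun i => span_pureStates (n i)) A)
    rintro _ ⟨P, hP, rfl⟩
    exact ⟨P, hP, rfl⟩
  refine eq_top_iff.2 fun A _ => ?_
  rw [matrix_eq_sum_single A]
  refine Submodule.sum_mem _ fun r _ => Submodule.sum_mem _ fun c _ => ?_
  have h : single r c (A r c) = A r c • tensor fun i => single (r i) (c i) (1 : ℂ) := by
    ext i j
    simp only [tensor, single_apply, Matrix.smul_apply, of_apply, smul_eq_mul, funext_iff,
      Finset.prod_ite_zero, ← forall_and]
    simp
  rw [h]
  exact Submodule.smul_mem _ _ (hT _)

theorem conjTranspose_of_mem_productPureStates {Z : MultiMat n} (hZ : Z ∈ productPureStates n) :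
    Zᴴ = Z := by
  obtain ⟨P, hP, rfl⟩ := hZ
  rw [conjTranspose_tensor]
  exact congrArg tensor (funext fun i => (hP i).1.eq)

theorem trace_mul_self_of_mem_productPureStates {Z : MultiMat n} (hZ : Z ∈ productPureStates n) :
    (Z * Z).trace = 1 := by
  obtain ⟨P, hP, rfl⟩ := hZ
  rw [trace_tensor_mul_tensor]
  exact Finset.prod_eq_one fun i _ => trace_mul_self_of_mem_pureStates (hP i)

theorem trace_tensor_mul_update_one {P : ∀ i, Mat (n i)} (hP : ∀ i, (P i).trace = 1) (i : Fin k)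
    (A : Mat (n i)) : (tensor P * tensor (Function.update 1 i A)).trace = (P i * A).trace := by
  rw [trace_tensor_mul_tensor, ← Finset.mul_prod_erase _ _ (Finset.mem_univ i),
    Function.update_self, Finset.prod_eq_one, mul_one]
  intro j hj
  rw [Function.update_of_ne (Finset.ne_of_mem_erase hj), Pi.one_apply, mul_one, hP]

/-- The partial trace onto the factor `i`. -/
def partialTrace (n : Fin k → ℕ) (i : Fin k) : MultiMat n →ₗ[ℂ] Mat (n i) where
  toFun Z := of fun r c => (Z * tensor (Function.update 1 i (single c r (1 : ℂ)))).trace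
  map_add' X Y := by
    ext r c
    simp [add_mul]
  map_smul' a X := by
    ext r c
    simp

theorem partialTrace_tensor {P : ∀ i, Mat (n i)} (hP : ∀ i, (P i).trace = 1) (i : Fin k) :
    partialTrace n i (tensor P) = P i := by
  ext r c
  simp [partialTrace, trace_tensor_mul_update_one hP, trace_mul_single]

/-- The tuples of pure states. -/
abbrev PureTuple (n : Fin k → ℕ) : Type :=
  ∀ i, pureStates (n i)

/-- The product state of a tuple of pure states. -/
def PureTuple.state (x : PureTuple n) : MultiMat n :=
  tensor fun i => (x i : Mat (n i))

theorem PureTuple.trace_eq_one (x : PureTuple n) (i : Fin k) : (x i : Mat (n i)).trace = 1 :=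
  (x i).2.2.2

theorem PureTuple.partialTrace_state (x : PureTuple n) (i : Fin k) :
    partialTrace n i x.state = x i :=
  partialTrace_tensor x.trace_eq_one i

theorem PureTuple.state_injective : Function.Injective (PureTuple.state (n := n)) := by
  intro x y h
  funext i
  apply Subtype.ext
  rw [← x.partialTrace_state, ← y.partialTrace_state, h]

theorem PureTuple.state_mem (x : PureTuple n) : x.state ∈ productPureStates n :=
  ⟨_, fun i => (x i).2, rfl⟩

theorem exists_state_eq {Z : MultiMat n} (hZ : Z ∈ productPureStates n) :
    ∃ x : PureTuple n, x.state = Z := by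
  obtain ⟨P, hP, rfl⟩ := hZ
  exact ⟨fun i => ⟨P i, hP i⟩, rfl⟩

theorem trace_state_mul_update_update (x : PureTuple n) {i j : Fin k} (hij : i ≠ j)
    (A : Mat (n i)) (B : Mat (n j)) :
    (x.state * tensor (Function.update (Function.update 1 i A) j B)).trace =
      ((x i : Mat (n i)) * A).trace * ((x j : Mat (n j)) * B).trace := by
  rw [PureTuple.state, trace_tensor_mul_tensor, ← Finset.mul_prod_erase _ _ (Finset.mem_univ i),
    ← Finset.mul_prod_erase _ _ (Finset.mem_erase.2 ⟨hij.symm, Finset.mem_univ j⟩),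
    Finset.prod_eq_one, mul_one, Function.update_self, Function.update_of_ne hij,
    Function.update_self]
  intro l hl
  rw [Finset.mem_erase, Finset.mem_erase] at hl
  rw [Function.update_of_ne hl.1, Function.update_of_ne hl.2.1, Pi.one_apply, mul_one,
    x.trace_eq_one]

theorem trace_mul_one_sub {d : ℕ} {P Q : Mat d} (hP : P ∈ pureStates d) (hQ : Q ∈ pureStates d) :
    ∃ t : ℝ, 0 ≤ t ∧ (P * (1 - Q)).trace = t ∧ (t = 0 → P = Q) := by
  obtain ⟨t, -, ht1, ht⟩ := trace_mul_of_mem_pureStates hP hQ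
  refine ⟨1 - t, by linarith, ?_, fun h => eq_of_trace_mul_eq_one hP hQ ?_⟩
  · rw [mul_sub, mul_one, trace_sub, hP.2.2, ht]
    simp
  · rw [ht, show t = 1 by linarith, Complex.ofReal_one]

/-- Test both sides against `1 - x i` in slot `i` and `1 - y j` in slot `j`. The left side vanishes,
and the right side is a sum of two nonnegative products, so one factor of the first is zero. -/
theorem eq_or_eq_of_state_add_eq {x y z w : PureTuple n}
    (h : x.state + y.state = z.state + w.state) {i j : Fin k} (hij : i ≠ j) :
    z i = x i ∨ z j = y j := by
  obtain ⟨a, ha, hae, ha0⟩ := trace_mul_one_sub (z i).2 (x i).2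
  obtain ⟨b, hb, hbe, hb0⟩ := trace_mul_one_sub (z j).2 (y j).2
  obtain ⟨a', ha', hae', -⟩ := trace_mul_one_sub (w i).2 (x i).2
  obtain ⟨b', hb', hbe', -⟩ := trace_mul_one_sub (w j).2 (y j).2
  have h1 := congrArg (fun Z => (Z * tensor (Function.update (Function.update 1 i
    (1 - (x i : Mat (n i)))) j (1 - (y j : Mat (n j))))).trace) h
  have hx : ((x i : Mat (n i)) * (1 - x i)).trace = 0 := by
    rw [mul_sub, mul_one, mul_self_of_mem_pureStates (x i).2, sub_self, trace_zero]
  have hy : ((y j : Mat (n j)) * (1 - y j)).trace = 0 := by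
    rw [mul_sub, mul_one, mul_self_of_mem_pureStates (y j).2, sub_self, trace_zero]
  simp only [add_mul, trace_add, trace_state_mul_update_update _ hij, hx, hy, hae, hbe, hae',
    hbe', zero_mul, mul_zero, add_zero] at h1
  have h2 : 0 = a * b + a' * b' := by exact_mod_cast h1
  have h3 : a * b = 0 := by nlinarith [mul_nonneg ha hb, mul_nonneg ha' hb']
  exact (mul_eq_zero.1 h3).imp (fun h => Subtype.ext (ha0 h)) fun h => Subtype.ext (hb0 h)

/-- Two product states differ in exactly one factor if and only if their sum can be decomposed in
another way. -/
theorem exists_differOnlyAt_iff {x y : PureTuple n} :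
    (∃ i, DifferOnlyAt x y i) ↔
      x ≠ y ∧ ∃ z w : PureTuple n, z ≠ x ∧ z ≠ y ∧ x.state + y.state = z.state + w.state := by
  constructor
  · rintro ⟨i, hi⟩
    refine ⟨fun h => hi.1 (congrFun h i), ?_⟩
    obtain ⟨R, hR, S, hS, hRx, hRy, h⟩ := exists_add_eq_add (x i).2 (y i).2
      fun h => hi.1 (Subtype.ext h)
    have hst : ∀ T : pureStates (n i), PureTuple.state (Function.update x i T) =
        tensorMultilinear n (Function.update (fun j => (x j : Mat (n j))) i T) := fun T => by
      rw [tensorMultilinear_apply, PureTuple.state]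
      congr 1
      funext j
      by_cases hj : j = i
      · subst hj
        simp
      · simp [hj]
    refine ⟨Function.update x i ⟨R, hR⟩, Function.update x i ⟨S, hS⟩, ?_, ?_, ?_⟩
    · intro e
      exact hRx (by simpa using congrArg Subtype.val (congrFun e i))
    · intro e
      exact hRy (by simpa using congrArg Subtype.val (congrFun e i))
    · rw [hst, hst, ← MultilinearMap.map_update_add, ← h, MultilinearMap.map_update_add, ← hst,
        ← hst, Function.update_eq_self, hi.update_eq]
  · rintro ⟨hxy, z, w, hzx, hzy, h⟩
    obtain ⟨i, hi⟩ := Function.ne_iff.1 hzx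
    have h1 : ∀ j, j ≠ i → z j = y j := fun j hj =>
      (eq_or_eq_of_state_add_eq h hj.symm).resolve_left hi
    have h2 : z i ≠ y i := fun e => hzy (funext fun j => by
      by_cases hj : j = i
      · rw [hj, e]
      · exact h1 j hj)
    have h3 : ∀ j, j ≠ i → x j = y j := fun j hj => by
      rw [← h1 j hj]
      exact ((eq_or_eq_of_state_add_eq h hj).resolve_right h2).symm
    refine ⟨i, fun e => hxy (funext fun j => ?_), h3⟩
    by_cases hj : j = i
    · rw [hj, e]
    · exact h3 j hj

end Tensor

/-! ### From numerical ranges to maps permuting product states. -/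

section Reduction

variable {k : ℕ} {n : Fin k → ℕ} {Ψ : MultiMat n →ₗ[ℂ] MultiMat n}

theorem trace_dualMap_mul (Ψ : MultiMat n →ₗ[ℂ] MultiMat n) (T : MultiMat n) {Z : MultiMat n}
    (hZ : Z ∈ productPureStates n) : (dualMap Ψ T * Z).trace = (T * (Ψ Z)ᴴ).trace := by
  have h := congrArg star (hsInner_dualMap Ψ Z T)
  rw [hsInner, hsInner, ← trace_conjTranspose, ← trace_conjTranspose, conjTranspose_mul,
    conjTranspose_mul, conjTranspose_conjTranspose, conjTranspose_conjTranspose,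
    conjTranspose_of_mem_productPureStates hZ] at h
  exact h.symm

theorem subset_image_of_convexHull_eq
    (h : ∀ T, convexHull ℝ (productRange (dualMap Ψ T)) = convexHull ℝ (productRange T)) :
    productPureStates n ⊆ Ψ '' productPureStates n := by
  intro P hP
  have hP1 := trace_mul_self_of_mem_productPureStates hP
  have hPs := conjTranspose_of_mem_productPureStates hP
  obtain ⟨Z, hZ, hPZ⟩ : ∃ Z ∈ productPureStates n, 1 ≤ (P * (Ψ Z)ᴴ).trace.re := by
    by_contra! hlt
    have hsub : productRange (dualMap Ψ P) ⊆ {w | w.re < 1} := by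
      rintro _ ⟨Z, hZ, rfl⟩
      rw [trace_dualMap_mul Ψ P hZ]
      exact hlt Z hZ
    have hmem : (1 : ℂ) ∈ convexHull ℝ (productRange (dualMap Ψ P)) := by
      rw [h]
      exact subset_convexHull ℝ _ ⟨P, hP, hP1.symm⟩
    have := convexHull_min hsub (convex_halfSpace_re_lt 1) hmem
    simp at this
  have hnorm : (Ψ Z * (Ψ Z)ᴴ).trace.re ≤ 1 := by
    -- Here `b = ‖Ψ Z‖²` is the real part of a point of the range of `Ψ*(Ψ Z)`, hence of the hull
    -- for `Ψ Z`. There `2 Re ⟨X, Y⟩ ≤ ‖X‖² + ‖Y‖²` bounds real parts by `(b + 1) / 2`, so `b ≤ 1`.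
    set b := (Ψ Z * (Ψ Z)ᴴ).trace.re
    have hsub : productRange (Ψ Z) ⊆ {w | w.re ≤ (b + 1) / 2} := by
      rintro _ ⟨Z', hZ', rfl⟩
      have := two_mul_re_trace_conjTranspose_mul_le (Ψ Z)ᴴ Z'
      rw [conjTranspose_conjTranspose, conjTranspose_of_mem_productPureStates hZ',
        trace_mul_self_of_mem_productPureStates hZ', Complex.one_re] at this
      change (Ψ Z * Z').trace.re ≤ _
      linarith
    have hmem : (Ψ Z * (Ψ Z)ᴴ).trace ∈ convexHull ℝ (productRange (Ψ Z)) := by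
      rw [← h]
      exact subset_convexHull ℝ _ ⟨Z, hZ, (trace_dualMap_mul Ψ _ hZ).symm⟩
    have : b ≤ (b + 1) / 2 := convexHull_min hsub (convex_halfSpace_re_le _) hmem
    linarith
  have hPY : P = (Ψ Z)ᴴ := by
    apply eq_of_re_trace_conjTranspose_mul_eq_one
    · rw [hPs, hP1, Complex.one_re]
    · rwa [conjTranspose_conjTranspose]
    · rwa [hPs]
  exact ⟨Z, hZ, by rw [← conjTranspose_conjTranspose (Ψ Z), ← hPY, hPs]⟩

theorem bijective_of_subset_image (h : productPureStates n ⊆ Ψ '' productPureStates n) :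
    Function.Bijective Ψ := by
  have hs : Function.Surjective Ψ := by
    rw [← LinearMap.range_eq_top, eq_top_iff, ← span_productPureStates n, Submodule.span_le]
    exact fun Z hZ => Set.image_subset_range _ _ (h hZ)
  exact ⟨LinearMap.injective_iff_surjective.2 hs, hs⟩

theorem dualMap_dualMap_of_comp_eq_id {Φ : MultiMat n →ₗ[ℂ] MultiMat n}
    (h : ∀ X, Φ (Ψ X) = X) (T : MultiMat n) : dualMap Ψ (dualMap Φ T) = T := by
  have h1 := eq_dualMap LinearMap.id (fun Y => dualMap Ψ (dualMap Φ Y)) (fun X Y => by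
    rw [← hsInner_dualMap, ← hsInner_dualMap, h, LinearMap.id_apply]) T
  have h2 := eq_dualMap LinearMap.id (fun Y : MultiMat n => Y) (fun X Y => rfl) T
  exact h1.trans h2.symm

theorem image_eq_of_convexHull_eq
    (h : ∀ T, convexHull ℝ (productRange (dualMap Ψ T)) = convexHull ℝ (productRange T)) :
    Ψ '' productPureStates n = productPureStates n := by
  have hsub := subset_image_of_convexHull_eq h
  set e := LinearEquiv.ofBijective Ψ (bijective_of_subset_image hsub)
  have he : ∀ X, e.symm.toLinearMap (Ψ X) = X := fun X => e.symm_apply_apply X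
  have hsub' : productPureStates n ⊆ e.symm.toLinearMap '' productPureStates n :=
    subset_image_of_convexHull_eq fun T => by
      rw [← h, dualMap_dualMap_of_comp_eq_id he]
  refine Set.Subset.antisymm ?_ hsub
  rintro _ ⟨Z, hZ, rfl⟩
  obtain ⟨Y, hY, rfl⟩ := hsub' hZ
  have : Ψ (e.symm Y) = Y := e.apply_symm_apply Y
  simpa [this] using hY

theorem productRange_dualMap_of_image_eq (h : Ψ '' productPureStates n = productPureStates n)
    (T : MultiMat n) : productRange (dualMap Ψ T) = productRange T := by
  ext w
  constructor
  · rintro ⟨Z, hZ, rfl⟩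
    have hΨ : Ψ Z ∈ productPureStates n := h ▸ Set.mem_image_of_mem Ψ hZ
    exact ⟨Ψ Z, hΨ, by rw [trace_dualMap_mul Ψ T hZ, conjTranspose_of_mem_productPureStates hΨ]⟩
  · rintro ⟨Y, hY, rfl⟩
    obtain ⟨Z, hZ, rfl⟩ : Y ∈ Ψ '' productPureStates n := by rwa [h]
    exact ⟨Z, hZ, by rw [trace_dualMap_mul Ψ T hZ, conjTranspose_of_mem_productPureStates hY]⟩

end Reduction

/-! ### Maps permuting product states have product form. -/

section ProductForm

theorem IsStandard.image_pureStates {d : ℕ} {ψ : Mat d →ₗ[ℂ] Mat d} (h : IsStandard ψ) :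
    ψ '' pureStates d = pureStates d := by
  obtain ⟨U, hU, h⟩ := h
  have conj_mem : ∀ V ∈ unitaryGroup (Fin d) ℂ, ∀ P ∈ pureStates d,
      V * P * Vᴴ ∈ pureStates d := by
    intro V hV P hP
    obtain ⟨v, hv, rfl⟩ := mem_pureStates_iff.1 hP
    rw [mul_vecMulVec, vecMulVec_mul, ← star_mulVec]
    refine vecMulVec_star_mem_pureStates ?_
    rw [star_mulVec, dotProduct_mulVec, vecMul_vecMul, ← star_eq_conjTranspose,
      mem_unitaryGroup_iff'.1 hV, vecMul_one, hv]
  have transpose_mem : ∀ P ∈ pureStates d, Pᵀ ∈ pureStates d := by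
    intro P hP
    obtain ⟨v, hv, rfl⟩ := mem_pureStates_iff.1 hP
    rw [transpose_vecMulVec]
    have := vecMulVec_star_mem_pureStates (v := star v) (by rw [star_star, dotProduct_comm, hv])
    rwa [star_star] at this
  have hU1 : U * Uᴴ = 1 := mem_unitaryGroup_iff.1 hU
  have hcancel : ∀ X : Mat d, U * (Uᴴ * X * Uᴴᴴ) * Uᴴ = X := fun X => by
    rw [conjTranspose_conjTranspose, Matrix.mul_assoc, Matrix.mul_assoc, hU1, mul_one,
      ← Matrix.mul_assoc, hU1, one_mul]
  have hback : ∀ P ∈ pureStates d, Uᴴ * P * Uᴴᴴ ∈ pureStates d :=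
    conj_mem Uᴴ (mem_unitaryGroup_iff.2 (by
      simpa [star_eq_conjTranspose] using mem_unitaryGroup_iff'.1 hU))
  apply Set.Subset.antisymm
  · rintro _ ⟨P, hP, rfl⟩
    rcases h with h | h
    · rw [h]
      exact conj_mem U hU P hP
    · rw [h]
      exact conj_mem U hU _ (transpose_mem P hP)
  · intro P hP
    rcases h with h | h
    · exact ⟨_, hback P hP, by rw [h, hcancel]⟩
    · exact ⟨_, transpose_mem _ (hback P hP), by rw [h, transpose_transpose, hcancel]⟩

theorem reindex_finCongr_mem_pureStates {a b : ℕ} (h : a = b) {P : Mat a} :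
    Matrix.reindex (finCongr h) (finCongr h) P ∈ pureStates b ↔ P ∈ pureStates a := by
  subst h
  simp

variable {k : ℕ} {n : Fin k → ℕ} {Ψ : MultiMat n →ₗ[ℂ] MultiMat n}

theorem HasProductForm.image_eq (h : HasProductForm Ψ) :
    Ψ '' productPureStates n = productPureStates n := by
  obtain ⟨π, hπ, ψ, hψ, h⟩ := h
  apply Set.Subset.antisymm
  · rintro _ ⟨_, ⟨P, hP, rfl⟩, rfl⟩
    refine ⟨_, fun i => ?_, h P⟩
    rw [← (hψ i).image_pureStates]
    exact Set.mem_image_of_mem _ ((reindex_finCongr_mem_pureStates (hπ i)).2 (hP (π i)))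
  · rintro _ ⟨P, hP, rfl⟩
    have hex : ∀ i, ∃ B ∈ pureStates (n (π i)),
        ψ i (Matrix.reindex (finCongr (hπ i)) (finCongr (hπ i)) B) = P i := by
      intro i
      obtain ⟨Q, hQ, hQP⟩ : P i ∈ ψ i '' pureStates (n i) := by
        rw [(hψ i).image_pureStates]
        exact hP i
      refine ⟨(Matrix.reindex (finCongr (hπ i)) (finCongr (hπ i))).symm Q, ?_, ?_⟩
      · rw [← reindex_finCongr_mem_pureStates (hπ i), Equiv.apply_symm_apply]
        exact hQ
      · rw [Equiv.apply_symm_apply, hQP]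
    choose B hB hBP using hex
    set A : ∀ j, Mat (n j) := Equiv.piCongrLeft (fun j => Mat (n j)) π B
    have hA : ∀ i, A (π i) = B i := fun i => 
      Equiv.piCongrLeft_apply_apply (fun j => Mat (n j)) π B i
    refine ⟨tensor A, ⟨A, fun j => ?_, rfl⟩, ?_⟩
    · obtain ⟨i, rfl⟩ := π.surjective j
      rw [hA]
      exact hB i
    · rw [h]
      simp only [hA, hBP]

theorem nontrivial_pureStates {d : ℕ} (hd : 2 ≤ d) : Nontrivial (pureStates d) := by
  have hmem : ∀ i : Fin d, single i i (1 : ℂ) ∈ pureStates d := fun i => by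
    rw [← vecMulVec_col_one]
    exact frame_mem_pureStates (one_mem _) i
  refine ⟨⟨_, hmem ⟨0, by omega⟩⟩, ⟨_, hmem ⟨1, by omega⟩⟩, fun h => ?_⟩
  have h1 := congrFun (congrFun (congrArg Subtype.val h) ⟨0, by omega⟩) ⟨0, by omega⟩
  simp at h1

theorem surjective_of_pureStates_subset_range {a b : ℕ} {φ : Mat a →ₗ[ℂ] Mat b}
    (h : pureStates b ⊆ Set.range φ) : Function.Surjective φ := by
  rw [← LinearMap.range_eq_top, eq_top_iff, ← span_pureStates b, Submodule.span_le]
  exact h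

theorem le_of_surjective {a b : ℕ} {φ : Mat a →ₗ[ℂ] Mat b} (h : Function.Surjective φ) :
    b ≤ a := by
  have := LinearMap.finrank_le_finrank_of_surjective h
  simp only [Module.finrank_matrix, Fintype.card_fin, Module.finrank_self, mul_one] at this
  exact Nat.mul_self_le_mul_self_iff.1 this

/-- A linear map permuting the tuples of pure states permutes the factors and acts linearly on each
of them. -/
theorem exists_perm_linearMap (hn : ∀ i, 2 ≤ n i)
    (h : Ψ '' productPureStates n = productPureStates n) :
    ∃ (π : Equiv.Perm (Fin k)) (φ : ∀ i, Mat (n (π i)) →ₗ[ℂ] Mat (n i)),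
      (∀ i, φ i '' pureStates (n (π i)) = pureStates (n i)) ∧
      ∀ x : PureTuple n, Ψ x.state = tensor fun i => φ i (x (π i)) := by
  have hΨ := bijective_of_subset_image h.ge
  choose f hf using fun x : PureTuple n =>
    exists_state_eq (h ▸ Set.mem_image_of_mem Ψ x.state_mem : Ψ x.state ∈ productPureStates n)
  have hinj : Function.Injective f := fun x y hxy =>
    PureTuple.state_injective (hΨ.1 (by rw [← hf, ← hf, hxy]))
  have hsurj : Function.Surjective f := fun y => by
    obtain ⟨Z, hZ, hZy⟩ : y.state ∈ Ψ '' productPureStates n := by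
      rw [h]
      exact y.state_mem
    obtain ⟨x, rfl⟩ := exists_state_eq hZ
    exact ⟨x, PureTuple.state_injective (by rw [hf, hZy])⟩
  have hadd : ∀ x y z w : PureTuple n, (f x).state + (f y).state = (f z).state + (f w).state ↔
      x.state + y.state = z.state + w.state := fun x y z w => by
    rw [hf, hf, hf, hf, ← map_add, ← map_add, hΨ.1.eq_iff]
  have := fun i => nontrivial_pureStates (hn i)
  obtain ⟨π, hπ⟩ := exists_perm_of_differOnlyAt_iff hinj fun x y => by
    rw [exists_differOnlyAt_iff, exists_differOnlyAt_iff, hinj.ne_iff]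
    refine and_congr_right' ⟨?_, ?_⟩
    · rintro ⟨z, w, hx, hy, hs⟩
      exact ⟨f z, f w, hinj.ne hx, hinj.ne hy, (hadd x y z w).2 hs⟩
    · rintro ⟨z', w', hx, hy, hs⟩
      obtain ⟨z, rfl⟩ := hsurj z'
      obtain ⟨w, rfl⟩ := hsurj w'
      exact ⟨z, w, hinj.ne_iff.1 hx, hinj.ne_iff.1 hy, (hadd x y z w).1 hs⟩
  have x₀ : PureTuple n := fun i => Classical.arbitrary _
  -- All slots but `π i` are frozen at `x₀`; the choice is immaterial on pure states, since
  -- coordinate `i` of `f x` depends only on `x (π i)`.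
  set φ : ∀ i, Mat (n (π i)) →ₗ[ℂ] Mat (n i) := fun i => partialTrace n i ∘ₗ Ψ ∘ₗ
    (tensorMultilinear n).toLinearMap (fun j => (x₀ j : Mat (n j))) (π i)
  have hφ : ∀ (x : PureTuple n) i, φ i (x (π i)) = f x i := by
    intro x i
    have h1 : tensorMultilinear n (Function.update (fun j => (x₀ j : Mat (n j))) (π i) (x (π i))) =
        PureTuple.state (Function.update x₀ (π i) (x (π i))) := by
      rw [tensorMultilinear_apply, PureTuple.state]
      congr 1
      funext j
      by_cases hj : j = π i
      · subst hj
        simp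
      · simp [hj]
    simp only [φ, LinearMap.comp_apply, MultilinearMap.toLinearMap_apply]
    rw [h1, ← hf, PureTuple.partialTrace_state]
    exact congrArg Subtype.val (hπ _ _ i (by simp))
  refine ⟨π, φ, fun i => Set.Subset.antisymm ?_ ?_, fun x => ?_⟩
  · rintro _ ⟨P, hP, rfl⟩
    have h1 := hφ (Function.update x₀ (π i) ⟨P, hP⟩) i
    rw [Function.update_self] at h1
    rw [h1]
    exact Subtype.property _
  · intro P hP
    obtain ⟨x, hx⟩ := hsurj (Function.update x₀ i ⟨P, hP⟩)
    refine ⟨x (π i), Subtype.property _, ?_⟩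
    rw [hφ, hx, Function.update_self]
  · simp only [hφ]
    exact (hf x).symm

theorem hasProductForm_of_image_eq (hn : ∀ i, 2 ≤ n i)
    (h : Ψ '' productPureStates n = productPureStates n) : HasProductForm Ψ := by
  obtain ⟨π, φ, hφ, hΨ⟩ := exists_perm_linearMap hn h
  have hle : ∀ i, n i ≤ n (π i) := fun i =>
    le_of_surjective (surjective_of_pureStates_subset_range
      ((hφ i).ge.trans (Set.image_subset_range _ _)))
  -- Termwise inequalities between two families with the same sum are equalities.
  have hπ : ∀ i, n (π i) = n i := fun i =>
    ((Finset.sum_eq_sum_iff_of_le fun i _ => hle i).1 (Equiv.sum_comp π n).symm i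
      (Finset.mem_univ i)).symm
  refine ⟨π, hπ, fun i => φ i ∘ₗ (reindexLinearEquiv ℂ ℂ (finCongr (hπ i)) (finCongr (hπ i))).symm,
    fun i => isStandard_of_image_pureStates ?_, fun A => ?_⟩
  · refine Eq.trans ?_ (hφ i)
    ext P
    constructor
    · rintro ⟨Q, hQ, rfl⟩
      refine ⟨(Matrix.reindex (finCongr (hπ i)) (finCongr (hπ i))).symm Q, ?_, rfl⟩
      rwa [← reindex_finCongr_mem_pureStates (hπ i), Equiv.apply_symm_apply]
    · rintro ⟨Q, hQ, rfl⟩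
      have hQ' : Q ∈ pureStates (n (π i)) := hQ
      refine ⟨Matrix.reindex (finCongr (hπ i)) (finCongr (hπ i)) Q, ?_,
        congrArg (φ i) (Equiv.symm_apply_apply
          (Matrix.reindex (finCongr (hπ i)) (finCongr (hπ i))) Q)⟩
      exact (reindex_finCongr_mem_pureStates (hπ i)).2 hQ
  -- `F` is the difference of the two sides as multilinear maps. It vanishes on tuples of pure
  -- states, which span each slot.
  · set F : MultilinearMap ℂ (fun i => Mat (n i)) (MultiMat n) :=
      Ψ.compMultilinearMap (tensorMultilinear n) -
        (MultilinearMap.domDomCongrLinearEquiv' ℂ ℂ (fun i => Mat (n i)) (MultiMat n) π.symm).symm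
          ((tensorMultilinear n).compLinearMap φ)
    have hF : ∀ A, F A = Ψ (tensor A) - tensor fun i => φ i (A (π i)) := fun A => rfl
    have hA := multilinearMap_apply_mem_span F (fun i => span_pureStates (n i)) A
    have h0 : F '' {x | ∀ i, x i ∈ pureStates (n i)} ⊆ {0} := by
      rintro _ ⟨P, hP, rfl⟩
      rw [hF, Set.mem_singleton_iff, sub_eq_zero]
      exact hΨ fun i => ⟨P i, hP i⟩
    have h1 := Submodule.span_mono h0 hA
    rw [Submodule.span_zero_singleton, Submodule.mem_bot, hF, sub_eq_zero] at h1
    rw [h1]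
    exact congrArg tensor (funext fun i =>
      congrArg (φ i) (Equiv.symm_apply_apply (Matrix.reindex (finCongr (hπ i)) (finCongr (hπ i)))
        (A (π i))).symm)

end ProductForm

end ProductNumericalRange

theorem theorem4p2 (k : ℕ) (hk : 1 < k) (n : Fin k → ℕ) (hmono : Antitone n)
    (hn : ∀ i, 2 ≤ n i)
    (Ψ : ProductNumericalRange.MultiMat n →ₗ[ℂ] ProductNumericalRange.MultiMat n) :
    List.TFAE [
      ∀ T : ProductNumericalRange.MultiMat n,
        ProductNumericalRange.productRange (ProductNumericalRange.dualMap Ψ T) =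
          ProductNumericalRange.productRange T,
      ∀ T : ProductNumericalRange.MultiMat n,
        convexHull ℝ (ProductNumericalRange.productRange (ProductNumericalRange.dualMap Ψ T)) =
          convexHull ℝ (ProductNumericalRange.productRange T),
      ProductNumericalRange.HasProductForm Ψ] := by
  tfae_have 1 → 2 := fun h T => by rw [h]
  tfae_have 2 → 3 := fun h => ProductNumericalRange.hasProductForm_of_image_eq hn
    (ProductNumericalRange.image_eq_of_convexHull_eq h)
  tfae_have 3 → 1 := fun h => ProductNumericalRange.productRange_dualMap_of_image_eq h.image_eq
  tfae_finish
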